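/- Let $M=\mathbb{C}\mathrm{H}^k$, $k\ge 1$, be the complex hyperbolic space, with complex structure $J$ and with the metric normalized to have holomorphic sectional curvature $-4$ (so the sectional curvatures lie in $[-4,-1]$ if $k\ge 2$, and $M$ is the hyperbolic plane of curvature $-4$ if $k=1$). Let $\mathcal R$ be the curvature tensor of $M$, with the sign for which $\langle \mathcal R(x,y)y,x\rangle$ is the sectional curvature of an orthonormal pair $x,y$. A complex hyperbolic plane in $M$ is a totally geodesic surface $\exp_b(\mathrm{span}_{\mathbb R}(u,v))$, where $b\in M$, $u,v\in T_bM$ are orthonormal and $\mathcal R(v,u)u=-4v$. Let $E\subset M$ be a complex hyperbolic plane and let $E^\perp$ be its normal bundle; write $E^\perp_aM=(T_aE)^\perp\subset T_aM$ for its fiber at $a\in E$ and $U_aE^\perp$ for the unit sphere of $E^\perp_aM$. The sphere $U_aE^\perp$ is fibered by the circles $T_aL\cap U_aE^\perp$, where $L$ runs over the complex hyperbolic planes through $a$ that are contained in the orthogonal complement $\exp_a(E^\perp_aM)$ to $E$ at $a$. The holonomy of $E^\perp$ along a loop in $E$ is the parallel translation of normal vectors along this loop with respect to the Levi-Civita connection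 of $M$. Then: 1. For every $a\in E$ and every piecewise smooth loop in $E$ with vertex $a$, the holonomy along the loop is a well-defined map $E^\perp_aM\to E^\perp_aM$, and it maps every circle $T_aL\cap U_aE^\perp$ of the above fibration onto itself. 2. If $k\ge 2$, then $E^\perp$ is not flat: it is not true that every point $a\in E$ has a neighbourhood in $E$ such that the holonomy of $E^\perp$ along every piecewise smooth loop in this neighbourhood with vertex $a$ is the identity. 3. For every $a\in E$, every unit vector $x\in T_aE$ and every $z\in U_aE^\perp$, one has $\mathcal R(x,Jx)z=2Jz$. -/

import Mathlib

open Set Filter Topology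
open scoped ContDiff

/-! ## Riemannian geometry in a global chart

A Riemannian metric on an open subset of a real normed space `V` is given by its value
`g p : V →L[ℝ] V →L[ℝ] ℝ` at every point `p`; all tangent spaces are identified with `V`. -/

namespace ChartGeometry

variable {V : Type*} [NormedAddCommGroup V] [NormedSpace ℝ V]

/-- The right-hand side of the Koszul formula for constant vector fields `u`, `v`, `w`, as a
linear form in `w`: half of `D_u g(v, w) + D_v g(u, w) - D_w g(u, v)` at `p`. -/
noncomputable def koszulForm (g : V → V →L[ℝ] V →L[ℝ] ℝ) (p u v : V) : V →L[ℝ] ℝ :=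
  (1 / 2 : ℝ) •
    (fderiv ℝ g p u v + fderiv ℝ g p v u - ((fderiv ℝ g p).flip u).flip v)

/-- The Christoffel map `Γ_p(u, v)` of the Levi-Civita connection of `g`: the vector that
represents the Koszul form with respect to `g p` (see `metric_christoffel`). -/
noncomputable def christoffel (g : V → V →L[ℝ] V →L[ℝ] ℝ) (p u v : V) : V :=
  (g p).inverse (koszulForm g p u v)

theorem metric_christoffel (g : V → V →L[ℝ] V →L[ℝ] ℝ) (p : V) (hp : (g p).IsInvertible)
    (u v w : V) :
    g p (christoffel g p u v) w =
      (1 / 2 : ℝ) * (fderiv ℝ g p u v w + fderiv ℝ g p v u w - fderiv ℝ g p w u v) := by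
  obtain ⟨e, he⟩ := hp
  have h : g p (christoffel g p u v) = koszulForm g p u v := by
    rw [christoffel, ← he]
    simp
  rw [h]
  simp [koszulForm]

/-- The Levi-Civita covariant derivative `∇_X Y` of vector fields. -/
noncomputable def cov (g : V → V →L[ℝ] V →L[ℝ] ℝ) (X Y : V → V) (p : V) : V :=
  fderiv ℝ Y p (X p) + christoffel g p (X p) (Y p)

/-- The curvature tensor `R(x, y)z = ∇_X ∇_Y Z - ∇_Y ∇_X Z - ∇_[X,Y] Z` at `p`, computed with the
constant extensions of `x`, `y`, `z` (for which `[X, Y] = 0`). With this sign the sectional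
curvature of an orthonormal pair is `⟨R(x, y)y, x⟩`. -/
noncomputable def curvature (g : V → V →L[ℝ] V →L[ℝ] ℝ) (p x y z : V) : V :=
  cov g (fun _ => x) (cov g (fun _ => y) (fun _ => z)) p
    - cov g (fun _ => y) (cov g (fun _ => x) (fun _ => z)) p

/-- The covariant derivative of a vector field `W` along the curve `c`. -/
noncomputable def covAlong (g : V → V →L[ℝ] V →L[ℝ] ℝ) (c W : ℝ → V) (t : ℝ) : V :=
  deriv W t + christoffel g (c t) (deriv c t) (W t)

/-- Complete geodesics of the metric `g` on `U`. -/
def IsGeodesic (U : Set V) (g : V → V →L[ℝ] V →L[ℝ] ℝ) (c : ℝ → V) : Prop :=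
  ContDiff ℝ ∞ c ∧ ∀ t, c t ∈ U ∧ covAlong g c (deriv c) t = 0

/-- The image `exp_a(S)` of a set `S` of tangent vectors at `a` under the exponential map. -/
def expImage (U : Set V) (g : V → V →L[ℝ] V →L[ℝ] ℝ) (a : V) (S : Set V) : Set V :=
  {q | ∃ c : ℝ → V, IsGeodesic U g c ∧ c 0 = a ∧ deriv c 0 ∈ S ∧ c 1 = q}

/-- The tangent space at `a` of a subset `E` (a submanifold in the applications): velocities at `a`
of smooth curves in `E`. -/
def tangentDirs (E : Set V) (a : V) : Set V :=
  {x | ∃ c : ℝ → V, ContDiffAt ℝ ∞ c 0 ∧ (∀ᶠ t in 𝓝 0, c t ∈ E) ∧ c 0 = a ∧ deriv c 0 = x}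

/-- The fiber at `a` of the normal bundle of `E`. -/
def normalSpace (g : V → V →L[ℝ] V →L[ℝ] ℝ) (E : Set V) (a : V) : Set V :=
  {z | ∀ x ∈ tangentDirs E a, g a x z = 0}

/-- The unit sphere in the fiber at `a` of the normal bundle of `E`. -/
def unitNormalSphere (g : V → V →L[ℝ] V →L[ℝ] ℝ) (E : Set V) (a : V) : Set V :=
  {z ∈ normalSpace g E a | g a z z = 1}

/-- `c`, restricted to `[0, 1]`, is a piecewise smooth loop in `E` with vertex `a`. -/
def IsPiecewiseSmoothLoop (E : Set V) (a : V) (c : ℝ → V) : Prop :=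
  ContinuousOn c (Icc 0 1) ∧ (∀ t ∈ Icc (0 : ℝ) 1, c t ∈ E) ∧ c 0 = a ∧ c 1 = a ∧
    ∃ (n : ℕ) (τ : ℕ → ℝ), Monotone τ ∧ τ 0 = 0 ∧ τ n = 1 ∧
      ∀ i < n, ContDiffOn ℝ ∞ c (Icc (τ i) (τ (i + 1)))

/-- `W` is a parallel vector field along the piecewise smooth curve `c` on `[0, 1]`: it is
continuous, and its covariant derivative vanishes except possibly at finitely many times. -/
def IsParallelAlong (g : V → V →L[ℝ] V →L[ℝ] ℝ) (c W : ℝ → V) : Prop :=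
  ContinuousOn W (Icc 0 1) ∧
    ∃ S : Finset ℝ, ∀ t ∈ Ioo (0 : ℝ) 1, t ∉ S → DifferentiableAt ℝ W t ∧ covAlong g c W t = 0

/-- `w` is the parallel translate of `v` along `c : [0, 1] → V`. -/
def ParallelTranslate (g : V → V →L[ℝ] V →L[ℝ] ℝ) (c : ℝ → V) (v w : V) : Prop :=
  ∃ W : ℝ → V, IsParallelAlong g c W ∧ W 0 = v ∧ W 1 = w

/-- The normal bundle of `E`, with the parallel translation of the ambient Levi-Civita connection,
is flat: its local holonomy is trivial, that is, every point of `E` has a neighbourhood in which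
parallel translation along every loop at that point is the identity on normal vectors. -/
def IsFlatNormalBundle (g : V → V →L[ℝ] V →L[ℝ] ℝ) (E : Set V) : Prop :=
  ∀ a ∈ E, ∃ N ∈ 𝓝 a, ∀ c : ℝ → V, IsPiecewiseSmoothLoop (E ∩ N) a c →
    ∀ z ∈ normalSpace g E a, ParallelTranslate g c z z

end ChartGeometry

/-! ## The complex hyperbolic space in the ball model -/

namespace ComplexHyperbolic

open ChartGeometry

/-- The underlying set of the ball model: the open unit ball of `ℂ^k`. -/
def ball (k : ℕ) : Set (EuclideanSpace ℂ (Fin k)) := Metric.ball 0 1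

/-- The complex hyperbolic metric
`g_p(u, v) = Re ⟨u, v⟩ / (1 - |p|²) + Re (conj ⟨p, u⟩ * ⟨p, v⟩) / (1 - |p|²)²`,
normalized so that the sectional curvatures lie in `[-4, -1]`
(and the curvature is `-4` if `k = 1`). -/
noncomputable def metric (k : ℕ) (p : EuclideanSpace ℂ (Fin k)) :
    EuclideanSpace ℂ (Fin k) →L[ℝ] EuclideanSpace ℂ (Fin k) →L[ℝ] ℝ :=
  (1 - ‖p‖ ^ 2)⁻¹ • innerSL ℝ +
    ((1 - ‖p‖ ^ 2) ^ 2)⁻¹ •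
      (innerSL ℝ : ℂ →L[ℝ] ℂ →L[ℝ] ℝ).bilinearComp
        ((innerSL ℂ p).restrictScalars ℝ) ((innerSL ℂ p).restrictScalars ℝ)

theorem metric_apply (k : ℕ) (p u v : EuclideanSpace ℂ (Fin k)) :
    metric k p u v = (inner ℂ u v).re / (1 - ‖p‖ ^ 2)
      + (star (inner ℂ p u) * inner ℂ p v).re / (1 - ‖p‖ ^ 2) ^ 2 := by
  have h : (inner ℝ u v : ℝ) = (inner ℂ u v : ℂ).re := by
    simp [PiLp.inner_apply, Complex.inner]
  have h' : (innerSL ℝ u : EuclideanSpace ℂ (Fin k) →L[ℝ] ℝ) v = (inner ℂ u v : ℂ).re := h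
  simp only [metric, add_apply, smul_apply, h', smul_eq_mul,
    ContinuousLinearMap.bilinearComp_apply, innerSL_apply_apply, Complex.inner,
    ContinuousLinearMap.coe_restrictScalars', Complex.star_def]
  rw [mul_comm (inner ℂ p v : ℂ)]
  ring

theorem metric_pos (k : ℕ) (p u : EuclideanSpace ℂ (Fin k)) (hp : p ∈ ball k) (hu : u ≠ 0) :
    0 < metric k p u u := by
  have h1 : ‖p‖ < 1 := by simpa [ball] using hp
  have h2 : 0 < 1 - ‖p‖ ^ 2 := by nlinarith [norm_nonneg p]
  have h3 : 0 < (inner ℂ u u : ℂ).re := by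
    have h := norm_sq_eq_re_inner (𝕜 := ℂ) u
    rw [RCLike.re_eq_complex_re] at h
    rw [← h]
    exact pow_pos (norm_pos_iff.2 hu) 2
  have h4 : 0 ≤ (star (inner ℂ p u : ℂ) * inner ℂ p u).re := by
    simp only [Complex.star_def, ← Complex.normSq_eq_conj_mul_self, Complex.ofReal_re]
    exact Complex.normSq_nonneg _
  rw [metric_apply]
  exact add_pos_of_pos_of_nonneg (div_pos h3 h2) (div_nonneg h4 (sq_nonneg _))

/-- The metric is nondegenerate on the ball, so that `christoffel` is not a default value there. -/
theorem metric_isInvertible (k : ℕ) (p : EuclideanSpace ℂ (Fin k)) (hp : p ∈ ball k) :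
    (metric k p).IsInvertible := by
  have hinj : Function.Injective
      (LinearMap.toContinuousLinearMap.symm.toLinearMap ∘ₗ (metric k p).toLinearMap :
        EuclideanSpace ℂ (Fin k) →ₗ[ℝ] Module.Dual ℝ (EuclideanSpace ℂ (Fin k))) := by
    rw [injective_iff_map_eq_zero]
    intro u hu
    by_contra hne
    have h := metric_pos k p u hp hne
    have h0 : metric k p u u = 0 := by simpa using LinearMap.congr_fun hu u
    exact h.ne' h0
  let e := (LinearEquiv.ofInjectiveOfFinrankEq _ hinj
    (Subspace.dual_finrank_eq (K := ℝ) (V := EuclideanSpace ℂ (Fin k))).symm).trans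
      (LinearMap.toContinuousLinearMap (𝕜 := ℝ) (E := EuclideanSpace ℂ (Fin k)) (F' := ℝ))
  refine ⟨e.toContinuousLinearEquiv, ?_⟩
  ext u v
  rfl

/-- A complex hyperbolic plane: the image under some `exp_b` of the plane spanned by a unit vector
`u` and a unit vector `v ⊥ u` in the `-4`-eigenspace of the curvature operator `R(·, u)u`. -/
def IsComplexPlane (k : ℕ) (E : Set (EuclideanSpace ℂ (Fin k))) : Prop :=
  ∃ b ∈ ball k, ∃ u v : EuclideanSpace ℂ (Fin k),
    metric k b u u = 1 ∧ metric k b v v = 1 ∧ metric k b u v = 0 ∧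
      curvature (metric k) b v u u = (-4 : ℝ) • v ∧
      E = expImage (ball k) (metric k) b (Submodule.span ℝ {u, v})

/-- The complex structure on the tangent spaces. -/
noncomputable def J {k : ℕ} (z : EuclideanSpace ℂ (Fin k)) : EuclideanSpace ℂ (Fin k) :=
  Complex.I • z

/-- The totally geodesic orthogonal complement to `E` at `a`. -/
def orthComplement (k : ℕ) (E : Set (EuclideanSpace ℂ (Fin k))) (a : EuclideanSpace ℂ (Fin k)) :
    Set (EuclideanSpace ℂ (Fin k)) :=
  expImage (ball k) (metric k) a (normalSpace (metric k) E a)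

/-- `C` is a fiber of the fibration of the unit normal sphere of `E` at `a` by complex circles:
`C` is its intersection with the tangent space `T_a L` of a complex hyperbolic plane `L` through
`a` that is contained in the orthogonal complement to `E` at `a`. -/
def IsFiber (k : ℕ) (E : Set (EuclideanSpace ℂ (Fin k))) (a : EuclideanSpace ℂ (Fin k))
    (C : Set (EuclideanSpace ℂ (Fin k))) : Prop :=
  ∃ L : Set (EuclideanSpace ℂ (Fin k)), IsComplexPlane k L ∧ a ∈ L ∧ L ⊆ orthComplement k E a ∧
    C = tangentDirs L a ∩ unitNormalSphere (metric k) E a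

end ComplexHyperbolic

/-! In the ball model the Christoffel map is Γ_p(u, v) = (⟨p, u⟩ v + ⟨p, v⟩ u) / (1 - |p|²)
(`christoffel_metric`). Since Γ_p(u, u) is a complex multiple of u, a geodesic never leaves a
complex affine line. Together with explicit geodesics joining any two points, this identifies each
complex hyperbolic plane with the slice of the ball by a complex affine line
(`IsComplexPlane.exists_eq_slice`). Differentiating Γ once gives R(x, y)z = (h(x, y) - h(y, x)) z +
h(x, z) y - h(y, z) x, where h is the Hermitian form of the metric (`curvature_metric`). For x
tangent and z normal, h(x, z) = h(Jx, z) = 0 and h(x, Jx) - h(Jx, x) = 2i, which is part 3.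

For parts 1 and 2 the parallel transport equation is solved in closed form. A normal vector z at a
extends along the slice to Z(p) = z + β (p - a) with a constant β, and exp(-∫ρ) Z(c) is parallel
along c, where ρ = ⟨c, c'⟩ / (1 - |c|²) (`parallelTranslate_of_normal`). On a loop Z returns to z,
so the holonomy is multiplication by a single complex number. Being isometric and complex scalar, it
preserves the unit circle of every normal complex line. On a small circle Im ∫ρ lies strictly
between 0 and 2π, so the factor is not 1 and the bundle is not flat. -/

namespace ChartGeometry

/-! ### Derivatives of the metric and the Levi-Civita connection -/

theorem hasDerivAt_metric_along {V : Type*} [NormedAddCommGroup V] [NormedSpace ℝ V]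
    {g : V → V →L[ℝ] V →L[ℝ] ℝ} {c X Y : ℝ → V} {c' X' Y' : V} {t : ℝ}
    (hg : DifferentiableAt ℝ g (c t)) (hc : HasDerivAt c c' t) (hX : HasDerivAt X X' t)
    (hY : HasDerivAt Y Y' t) :
    HasDerivAt (fun t => g (c t) (X t) (Y t))
      (fderiv ℝ g (c t) c' (X t) (Y t) + g (c t) X' (Y t) + g (c t) (X t) Y') t := by
  have h1 : HasDerivAt (fun t => g (c t)) (fderiv ℝ g (c t) c') t :=
    HasFDerivAt.comp_hasDerivAt (E := V →L[ℝ] V →L[ℝ] ℝ) (l := g) t hg.hasFDerivAt hc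
  simpa using (h1.clm_apply hX).clm_apply hY

end ChartGeometry

namespace ComplexHyperbolic

open ChartGeometry

variable {k : ℕ}

theorem one_sub_norm_sq_pos {p : EuclideanSpace ℂ (Fin k)} (hp : p ∈ ball k) :
    0 < 1 - ‖p‖ ^ 2 := by
  have h1 : ‖p‖ < 1 := by simpa [ball] using hp
  nlinarith [norm_nonneg p]

theorem isOpen_ball (k : ℕ) : IsOpen (ball k) := Metric.isOpen_ball

theorem contDiffOn_metric (k : ℕ) : ContDiffOn ℝ ∞ (metric k) (ball k) := by
  rw [contDiffOn_clm_apply]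
  intro u
  rw [contDiffOn_clm_apply]
  intro v
  simp only [metric_apply]
  have h1 : ContDiff ℝ ∞ fun p : EuclideanSpace ℂ (Fin k) => 1 - ‖p‖ ^ 2 :=
    contDiff_const.sub (contDiff_norm_sq ℝ)
  have h2 : ∀ w : EuclideanSpace ℂ (Fin k), ContDiff ℝ ∞ fun p => (inner ℂ p w : ℂ) :=
    fun w => contDiff_id.inner ℂ contDiff_const
  have h3 : ContDiff ℝ ∞ fun p : EuclideanSpace ℂ (Fin k) =>
      (star (inner ℂ p u) * inner ℂ p v : ℂ).re :=
    Complex.reCLM.contDiff.comp ((Complex.conjCLE.contDiff.comp (h2 u)).mul (h2 v))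
  refine (contDiffOn_const.div h1.contDiffOn fun p hp => ?_).add
    (h3.contDiffOn.div (h1.pow 2).contDiffOn fun p hp => ?_)
  · exact (one_sub_norm_sq_pos hp).ne'
  · exact (pow_pos (one_sub_norm_sq_pos hp) 2).ne'

theorem differentiableAt_metric {p : EuclideanSpace ℂ (Fin k)} (hp : p ∈ ball k) :
    DifferentiableAt ℝ (metric k) p :=
  ((contDiffOn_metric k).contDiffAt ((isOpen_ball k).mem_nhds hp)).differentiableAt (by simp)

theorem hasDerivAt_add_smul (p u : EuclideanSpace ℂ (Fin k)) (t : ℝ) :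
    HasDerivAt (fun t : ℝ => p + t • u) u t := by
  simpa using ((hasDerivAt_id t).smul_const u).const_add p

theorem hasDerivAt_one_sub_norm_sq {c : ℝ → EuclideanSpace ℂ (Fin k)}
    {c' : EuclideanSpace ℂ (Fin k)} {t : ℝ} (hc : HasDerivAt c c' t) :
    HasDerivAt (fun t => 1 - ‖c t‖ ^ 2) (-(2 * (inner ℂ (c t) c').re)) t := by
  have h := (hc.norm_sq).const_sub 1
  have h' : (inner ℝ (c t) c' : ℝ) = (inner ℂ (c t) c' : ℂ).re := by
    simp [PiLp.inner_apply, Complex.inner]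
  rwa [h'] at h

theorem hasDerivAt_inner_const {c : ℝ → EuclideanSpace ℂ (Fin k)}
    {c' : EuclideanSpace ℂ (Fin k)} {t : ℝ} (hc : HasDerivAt c c' t)
    (v : EuclideanSpace ℂ (Fin k)) :
    HasDerivAt (fun t => (inner ℂ (c t) v : ℂ)) (inner ℂ c' v) t := by
  simpa using hc.inner ℂ (hasDerivAt_const t v)

theorem fderiv_metric_apply {p : EuclideanSpace ℂ (Fin k)} (hp : p ∈ ball k)
    (u v w : EuclideanSpace ℂ (Fin k)) :
    fderiv ℝ (metric k) p u v w =
      (inner ℂ v w).re * (2 * (inner ℂ p u).re) / (1 - ‖p‖ ^ 2) ^ 2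
      + (star (inner ℂ u v) * inner ℂ p w + star (inner ℂ p v) * inner ℂ u w).re
          / (1 - ‖p‖ ^ 2) ^ 2
      + (star (inner ℂ p v) * inner ℂ p w).re * (4 * (inner ℂ p u).re) / (1 - ‖p‖ ^ 2) ^ 3 := by
  have hh := (one_sub_norm_sq_pos hp).ne'
  have hl := hasDerivAt_add_smul p u 0
  have h0 : p + (0 : ℝ) • u = p := by simp
  have h1 : HasDerivAt (fun t : ℝ => metric k (p + t • u) v w) (fderiv ℝ (metric k) p u v w) 0 := by
    have h2 := hasDerivAt_metric_along (g := metric k) (by rw [h0]; exact differentiableAt_metric hp)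
      hl (hasDerivAt_const (0 : ℝ) v) (hasDerivAt_const (0 : ℝ) w)
    simpa using h2
  have hn := hasDerivAt_one_sub_norm_sq hl
  have hp2 : HasDerivAt (fun t : ℝ =>
      (star (inner ℂ (p + t • u) v) * inner ℂ (p + t • u) w : ℂ).re)
      (star (inner ℂ u v) * inner ℂ p w + star (inner ℂ p v) * inner ℂ u w : ℂ).re 0 := by
    have h5 := ((hasDerivAt_inner_const hl v).star).mul (hasDerivAt_inner_const hl w)
    have h6 := Complex.reCLM.hasFDerivAt.comp_hasDerivAt (0 : ℝ) h5
    simpa [Function.comp_def] using h6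
  simp only [metric_apply] at h1
  have h7 := ((hasDerivAt_const (0 : ℝ) (inner ℂ v w).re).div hn (by simpa using hh)).add
    (hp2.div (hn.pow 2) (by simpa using pow_ne_zero 2 hh))
  rw [h1.unique h7]
  simp only [h0, Pi.pow_apply]
  field_simp
  ring

theorem injective_metric {p : EuclideanSpace ℂ (Fin k)} (hp : p ∈ ball k) :
    Function.Injective (metric k p) := by
  obtain ⟨e, he⟩ := metric_isInvertible k p hp
  rw [← he]
  exact e.injective

/-- By nondegeneracy it suffices to pair with an arbitrary `w` and compare with the Koszul formula.
The result is complex bilinear in `u` and `v`, which is what makes complex scalars commute with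
transport. -/
theorem christoffel_metric {p : EuclideanSpace ℂ (Fin k)} (hp : p ∈ ball k)
    (u v : EuclideanSpace ℂ (Fin k)) :
    christoffel (metric k) p u v =
      (inner ℂ p u / (1 - ‖p‖ ^ 2 : ℝ) : ℂ) • v + (inner ℂ p v / (1 - ‖p‖ ^ 2 : ℝ) : ℂ) • u := by
  apply injective_metric hp
  ext w
  have hh := (one_sub_norm_sq_pos hp).ne'
  rw [metric_christoffel _ _ (metric_isInvertible k p hp), fderiv_metric_apply hp,
    fderiv_metric_apply hp, fderiv_metric_apply hp, metric_apply]
  simp only [inner_add_left, inner_add_right, inner_smul_left, inner_smul_right]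
  rw [← inner_conj_symm w u, ← inner_conj_symm w v, ← inner_conj_symm v u]
  simp only [Complex.star_def, map_add, map_div₀, map_mul, Complex.conj_conj, Complex.add_re,
    Complex.mul_re, Complex.div_ofReal_re, Complex.div_ofReal_im, Complex.conj_re, Complex.conj_im,
    Complex.add_im, Complex.mul_im, Complex.conj_ofReal]
  field_simp
  ring

/-! ### The Hermitian form and the curvature tensor -/

/-- The Hermitian form with real part `metric k p`. -/
noncomputable def herm (p u v : EuclideanSpace ℂ (Fin k)) : ℂ :=
  inner ℂ u v / (1 - ‖p‖ ^ 2 : ℝ) + inner ℂ u p * inner ℂ p v / ((1 - ‖p‖ ^ 2 : ℝ) : ℂ) ^ 2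

theorem metric_eq_re_herm (p u v : EuclideanSpace ℂ (Fin k)) :
    metric k p u v = (herm p u v).re := by
  rw [metric_apply, herm, ← inner_conj_symm u p, Complex.add_re, Complex.div_ofReal_re,
    ← Complex.ofReal_pow, Complex.div_ofReal_re]
  rfl

theorem herm_conj_symm (p u v : EuclideanSpace ℂ (Fin k)) :
    star (herm p u v) = herm p v u := by
  simp only [herm, Complex.star_def, map_add, map_div₀, map_mul, map_pow, Complex.conj_ofReal,
    inner_conj_symm]
  ring

theorem herm_smul_right (p u v : EuclideanSpace ℂ (Fin k)) (a : ℂ) :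
    herm p u (a • v) = a * herm p u v := by
  simp only [herm, inner_smul_right]; ring

theorem herm_smul_left (p u v : EuclideanSpace ℂ (Fin k)) (a : ℂ) :
    herm p (a • u) v = star a * herm p u v := by
  simp only [herm, inner_smul_left, Complex.star_def]; ring

theorem cov_const_const (p y z : EuclideanSpace ℂ (Fin k)) :
    cov (metric k) (fun _ => y) (fun _ => z) p = christoffel (metric k) p y z := by
  simp [cov]

/-- The first two terms come from differentiating the coefficients ⟨q, ·⟩ / (1 - |q|²) of Γ_q(y, z)
in direction `x`. -/
theorem cov_cov_const {p : EuclideanSpace ℂ (Fin k)} (hp : p ∈ ball k)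
    (x y z : EuclideanSpace ℂ (Fin k)) :
    cov (metric k) (fun _ => x) (cov (metric k) (fun _ => y) (fun _ => z)) p =
      ((inner ℂ x y / (1 - ‖p‖ ^ 2 : ℝ)
        + inner ℂ p y * (2 * (inner ℂ p x).re : ℝ) / ((1 - ‖p‖ ^ 2 : ℝ) : ℂ) ^ 2 : ℂ)) • z
      + ((inner ℂ x z / (1 - ‖p‖ ^ 2 : ℝ)
        + inner ℂ p z * (2 * (inner ℂ p x).re : ℝ) / ((1 - ‖p‖ ^ 2 : ℝ) : ℂ) ^ 2 : ℂ)) • y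
      + christoffel (metric k) p x (christoffel (metric k) p y z) := by
  have hh := (one_sub_norm_sq_pos hp).ne'
  have hev : cov (metric k) (fun _ => y) (fun _ => z) =ᶠ[𝓝 p] fun p =>
      (inner ℂ p y / (1 - ‖p‖ ^ 2 : ℝ) : ℂ) • z + (inner ℂ p z / (1 - ‖p‖ ^ 2 : ℝ) : ℂ) • y := by
    filter_upwards [(isOpen_ball k).mem_nhds hp] with q hq
    rw [cov_const_const, christoffel_metric hq]
  rw [cov, cov_const_const, hev.fderiv_eq]
  congr 1
  have hl := hasDerivAt_add_smul p x 0
  have h0 : p + (0 : ℝ) • x = p := by simp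
  have hq : ∀ v : EuclideanSpace ℂ (Fin k),
      HasDerivAt (fun t : ℝ => (inner ℂ (p + t • x) v / (1 - ‖p + t • x‖ ^ 2 : ℝ) : ℂ))
        (inner ℂ x v / (1 - ‖p‖ ^ 2 : ℝ)
          + inner ℂ p v * (2 * (inner ℂ p x).re : ℝ) / ((1 - ‖p‖ ^ 2 : ℝ) : ℂ) ^ 2 : ℂ) 0 := by
    intro v
    have hc : ((1 - ‖p‖ ^ 2 : ℝ) : ℂ) ≠ 0 := by exact_mod_cast hh
    refine ((hasDerivAt_inner_const hl v).div (hasDerivAt_one_sub_norm_sq hl).ofReal_comp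
      ?_).congr_deriv ?_
    · simpa only [h0] using hc
    · simp only [h0]
      push_cast at hc ⊢
      field_simp
      ring
  have hd : DifferentiableAt ℝ (fun p : EuclideanSpace ℂ (Fin k) =>
      (inner ℂ p y / (1 - ‖p‖ ^ 2 : ℝ) : ℂ) • z + (inner ℂ p z / (1 - ‖p‖ ^ 2 : ℝ) : ℂ) • y) p := by
    have h1 : DifferentiableAt ℝ (fun p : EuclideanSpace ℂ (Fin k) =>
        ((1 - ‖p‖ ^ 2 : ℝ) : ℂ)) p :=
      Complex.ofRealCLM.differentiableAt.comp p
        ((differentiableAt_const _).sub ((differentiableAt_id).norm_sq ℝ))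
    have h2 : ∀ v : EuclideanSpace ℂ (Fin k), DifferentiableAt ℝ (fun p =>
        (inner ℂ p v / (1 - ‖p‖ ^ 2 : ℝ) : ℂ)) p := by
      intro v
      have h3 : DifferentiableAt ℝ (fun p : EuclideanSpace ℂ (Fin k) => (inner ℂ p v : ℂ)) p :=
        differentiableAt_id.inner ℂ (differentiableAt_const v)
      simp only [div_eq_mul_inv]
      exact h3.mul (h1.inv (Complex.ofReal_ne_zero.2 hh))
    exact ((h2 y).smul_const z).add ((h2 z).smul_const y)
  have hd' := hd.hasFDerivAt
  rw [← h0] at hd'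
  have h5 := HasFDerivAt.comp_hasDerivAt (f := fun t : ℝ => p + t • x) (0 : ℝ) hd' hl
  rw [h0] at h5
  exact h5.unique (((hq y).smul_const z).add ((hq z).smul_const y))

theorem curvature_metric {p : EuclideanSpace ℂ (Fin k)} (hp : p ∈ ball k)
    (x y z : EuclideanSpace ℂ (Fin k)) :
    curvature (metric k) p x y z =
      (herm p x y - herm p y x) • z + herm p x z • y - herm p y z • x := by
  have hh : ((1 - ‖p‖ ^ 2 : ℝ) : ℂ) ≠ 0 := by exact_mod_cast (one_sub_norm_sq_pos hp).ne'
  -- Splitting 2 Re⟨p, v⟩ into ⟨p, v⟩ + ⟨v, p⟩ turns the claim into a rational identity in inner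
  -- products; terms symmetric in `x` and `y` cancel.
  have hre : ∀ v : EuclideanSpace ℂ (Fin k),
      ((2 * (inner ℂ p v).re : ℝ) : ℂ) = inner ℂ p v + inner ℂ v p := by
    intro v
    rw [← inner_conj_symm v p, Complex.add_conj]
  rw [curvature, cov_cov_const hp, cov_cov_const hp, christoffel_metric hp, christoffel_metric hp,
    christoffel_metric hp, christoffel_metric hp]
  simp only [herm, hre, inner_add_right, inner_smul_right]
  match_scalars <;> field_simp <;> ring

theorem herm_self (p u : EuclideanSpace ℂ (Fin k)) : herm p u u = (metric k p u u : ℂ) := by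
  have h := herm_conj_symm p u u
  rw [metric_eq_re_herm]
  exact (Complex.conj_eq_iff_re.1 h).symm

/-! ### Geodesics and slices by complex affine subspaces -/

/-- The intersection of the ball with the affine subspace through `a` in direction `S`. -/
def slice (a : EuclideanSpace ℂ (Fin k)) (S : Submodule ℂ (EuclideanSpace ℂ (Fin k))) :
    Set (EuclideanSpace ℂ (Fin k)) :=
  {q | q ∈ ball k ∧ q - a ∈ S}

theorem slice_eq_of_mem {a p : EuclideanSpace ℂ (Fin k)}
    {S : Submodule ℂ (EuclideanSpace ℂ (Fin k))} (hp : p ∈ slice a S) : slice a S = slice p S := by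
  ext q
  refine and_congr_right fun _ => ?_
  rw [show q - a = (q - p) + (p - a) by abel]
  exact S.add_mem_iff_left hp.2

/-- The component of `c` orthogonal to `S` has zero derivative. -/
theorem sub_mem_of_deriv_mem {c : ℝ → EuclideanSpace ℂ (Fin k)}
    {S : Submodule ℂ (EuclideanSpace ℂ (Fin k))} (hc : Differentiable ℝ c)
    (hS : ∀ t, deriv c t ∈ S) (s t : ℝ) : c s - c t ∈ S := by
  set P : EuclideanSpace ℂ (Fin k) →L[ℝ] EuclideanSpace ℂ (Fin k) :=
    S.starProjection.restrictScalars ℝ with hP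
  have hPS : ∀ v, P v = v ↔ v ∈ S := fun v => S.starProjection_eq_self_iff
  have hd : ∀ t, HasDerivAt (fun t => c t - P (c t)) 0 t := by
    intro t
    have h1 := (hc t).hasDerivAt
    have h2 := h1.sub (P.hasFDerivAt.comp_hasDerivAt t h1)
    rw [(hPS _).2 (hS t), sub_self] at h2
    exact h2
  have h3 := is_const_of_deriv_eq_zero (fun t => (hd t).differentiableAt)
    (fun t => (hd t).deriv) s t
  rw [← hPS, map_sub]
  rw [sub_eq_sub_iff_sub_eq_sub] at h3
  exact h3.symm

/-- The geodesic equation is c'' = -f c' with a complex function f, so exp(∫f) c' is constant and c'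
keeps its complex direction. -/
theorem IsGeodesic.deriv_mem {c : ℝ → EuclideanSpace ℂ (Fin k)}
    (hc : IsGeodesic (ball k) (metric k) c) {S : Submodule ℂ (EuclideanSpace ℂ (Fin k))}
    (h0 : deriv c 0 ∈ S) (t : ℝ) : deriv c t ∈ S := by
  obtain ⟨hsm, hgeo⟩ := hc
  have hdc : ContDiff ℝ ∞ (deriv c) := (contDiff_infty_iff_deriv.1 hsm).2
  set f : ℝ → ℂ := fun t => 2 * (inner ℂ (c t) (deriv c t) / (1 - ‖c t‖ ^ 2 : ℝ)) with hf
  have hfc : Continuous f := by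
    have h1 : Continuous fun t => (inner ℂ (c t) (deriv c t) : ℂ) :=
      hsm.continuous.inner hdc.continuous
    have h2 : Continuous fun t => ((1 - ‖c t‖ ^ 2 : ℝ) : ℂ) :=
      Complex.continuous_ofReal.comp (continuous_const.sub (hsm.continuous.norm.pow 2))
    exact continuous_const.mul
      (h1.div h2 fun t => Complex.ofReal_ne_zero.2 (one_sub_norm_sq_pos (hgeo t).1).ne')
  have hF : ∀ t, HasDerivAt (fun t => ∫ s in (0 : ℝ)..t, f s) (f t) t := fun t =>
    (hfc.integral_hasStrictDerivAt 0 t).hasDerivAt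
  have hd : ∀ t, HasDerivAt (fun t => Complex.exp (∫ s in (0 : ℝ)..t, f s) • deriv c t) 0 t := by
    intro t
    have h1 := ((hF t).cexp).smul ((hdc.differentiable (by simp)) t).hasDerivAt
    refine h1.congr_deriv ?_
    have h2 := (hgeo t).2
    rw [covAlong, christoffel_metric (hgeo t).1] at h2
    rw [eq_neg_of_add_eq_zero_left h2, hf]
    module
  have h3 := is_const_of_deriv_eq_zero (fun t => (hd t).differentiableAt)
    (fun t => (hd t).deriv) t 0
  simp only [intervalIntegral.integral_same, Complex.exp_zero, one_smul] at h3
  rw [← h3] at h0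
  exact (S.smul_mem_iff (Complex.exp_ne_zero _)).1 h0

/-- In ℂ^{1,k} with the form |w|² - |A|², the hypotheses say that (η, Y) is orthogonal to (1, b) and
has the opposite norm. The curve cosh(st) (1, b) + sinh(st) (η, Y) thus has constant norm 1 - |b|²,
and `c` is its projection A / w to the ball. -/
theorem isGeodesic_of_lorentz {b Y : EuclideanSpace ℂ (Fin k)} (hb : b ∈ ball k) {η : ℂ}
    (hη : inner ℂ b Y = η) (hY : ‖Y‖ ^ 2 - ‖η‖ ^ 2 = 1 - ‖b‖ ^ 2) (s : ℝ) :
    let c := fun t : ℝ => ((Real.cosh (s * t) : ℂ) + Real.sinh (s * t) * η)⁻¹ •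
      ((Real.cosh (s * t) : ℂ) • b + (Real.sinh (s * t) : ℂ) • Y)
    IsGeodesic (ball k) (metric k) c ∧ deriv c 0 = (s : ℂ) • (Y - η • b) := by
  intro c
  have hh := one_sub_norm_sq_pos hb
  set w : ℝ → ℂ := fun t => (Real.cosh (s * t) : ℂ) + Real.sinh (s * t) * η with hw
  set A : ℝ → EuclideanSpace ℂ (Fin k) :=
    fun t => (Real.cosh (s * t) : ℂ) • b + (Real.sinh (s * t) : ℂ) • Y with hA
  have hη' : inner ℂ Y b = star η := by rw [← hη, ← inner_conj_symm]; rfl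
  have hbb : (inner ℂ b b : ℂ) = ((‖b‖ ^ 2 : ℝ) : ℂ) := by
    rw [inner_self_eq_norm_sq_to_K]; simp
  have hYY : (inner ℂ Y Y : ℂ) = ((1 - ‖b‖ ^ 2 + ‖η‖ ^ 2 : ℝ) : ℂ) := by
    rw [inner_self_eq_norm_sq_to_K, ← hY]; simp
  have hηη : star η * η = ((‖η‖ ^ 2 : ℝ) : ℂ) := by
    rw [Complex.star_def, ← Complex.normSq_eq_conj_mul_self, Complex.normSq_eq_norm_sq]
  have hcs : ∀ t, (Real.cosh (s * t) : ℂ) ^ 2 - (Real.sinh (s * t) : ℂ) ^ 2 = 1 := by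
    intro t
    exact_mod_cast Real.cosh_sq_sub_sinh_sq (s * t)
  have hwA : ∀ t, star (w t) * w t - inner ℂ (A t) (A t) = ((1 - ‖b‖ ^ 2 : ℝ) : ℂ) := by
    intro t
    simp only [hw, hA, inner_add_left, inner_add_right, inner_smul_left, inner_smul_right, hη, hη',
      hbb, hYY, Complex.star_def, map_add, map_mul, Complex.conj_ofReal]
    have h1 := hcs t
    rw [Complex.star_def] at hηη
    push_cast at hηη h1 ⊢
    linear_combination (1 - (‖b‖ : ℂ) ^ 2) * h1 + (Complex.sinh (s * t)) ^ 2 * hηη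
  have hwA' : ∀ t, ‖w t‖ ^ 2 - ‖A t‖ ^ 2 = 1 - ‖b‖ ^ 2 := by
    intro t
    have h1 := hwA t
    rw [inner_self_eq_norm_sq_to_K, Complex.star_def, ← Complex.normSq_eq_conj_mul_self,
      Complex.normSq_eq_norm_sq] at h1
    simp only [Complex.coe_algebraMap] at h1
    exact_mod_cast h1
  have hw0 : ∀ t, w t ≠ 0 := by
    intro t h
    have h1 := hwA' t
    rw [h, norm_zero] at h1
    nlinarith [sq_nonneg ‖A t‖]
  have hch : ∀ t, 1 - ‖c t‖ ^ 2 = (1 - ‖b‖ ^ 2) / ‖w t‖ ^ 2 := by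
    intro t
    have h1 : ‖w t‖ ≠ 0 := norm_ne_zero_iff.2 (hw0 t)
    change 1 - ‖(w t)⁻¹ • A t‖ ^ 2 = _
    rw [norm_smul, norm_inv, ← hwA' t]
    field_simp
  have hcb : ∀ t, c t ∈ ball k := by
    intro t
    have h1 : 0 < 1 - ‖c t‖ ^ 2 := by
      rw [hch]
      exact div_pos hh (pow_pos (norm_pos_iff.2 (hw0 t)) 2)
    rw [ball, mem_ball_zero_iff]
    nlinarith [norm_nonneg (c t)]
  have hst : ∀ t, HasDerivAt (fun t : ℝ => s * t) s t := fun t => by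
    simpa using (hasDerivAt_id t).const_mul s
  have hco : ∀ t, HasDerivAt (fun t : ℝ => (Real.cosh (s * t) : ℂ))
      ((Real.sinh (s * t) * s : ℝ) : ℂ) t := fun t => (hst t).cosh.ofReal_comp
  have hsi : ∀ t, HasDerivAt (fun t : ℝ => (Real.sinh (s * t) : ℂ))
      ((Real.cosh (s * t) * s : ℝ) : ℂ) t := fun t => (hst t).sinh.ofReal_comp
  have hwd : ∀ t, HasDerivAt w
      (s * ((Real.sinh (s * t) : ℂ) + Real.cosh (s * t) * η)) t := by
    intro t
    refine ((hco t).add ((hsi t).mul_const η)).congr_deriv ?_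
    push_cast
    ring
  have hAd : ∀ t, HasDerivAt A
      ((s : ℂ) • ((Real.sinh (s * t) : ℂ) • b + (Real.cosh (s * t) : ℂ) • Y)) t := by
    intro t
    refine (((hco t).smul_const b).add ((hsi t).smul_const Y)).congr_deriv ?_
    push_cast
    module
  have hcd : ∀ t, HasDerivAt c (((w t)⁻¹ ^ 2 * s) • (Y - η • b)) t := by
    intro t
    refine (((hwd t).inv (hw0 t)).smul (hAd t)).congr_deriv ?_
    have h1 := hcs t
    have h2 := hw0 t
    push_cast at h1
    simp only [hA, Pi.inv_apply]
    simp only [hw] at h2 ⊢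
    push_cast at h2
    match_scalars
    · field_simp
      linear_combination (-(s : ℂ) * η) * h1
    · field_simp
      linear_combination (s : ℂ) * h1
  have hdc : deriv c = fun t => ((w t)⁻¹ ^ 2 * s) • (Y - η • b) := funext fun t => (hcd t).deriv
  refine ⟨⟨?_, fun t => ⟨hcb t, ?_⟩⟩, ?_⟩
  · have hs : ContDiff ℝ ∞ fun t : ℝ => s * t := contDiff_const.mul contDiff_id
    have h1 : ContDiff ℝ ∞ fun t : ℝ => (Real.cosh (s * t) : ℂ) :=
      Complex.ofRealCLM.contDiff.comp (Real.contDiff_cosh.comp hs)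
    have h2 : ContDiff ℝ ∞ fun t : ℝ => (Real.sinh (s * t) : ℂ) :=
      Complex.ofRealCLM.contDiff.comp (Real.contDiff_sinh.comp hs)
    have h3 : ContDiff ℝ ∞ w := h1.add (h2.mul contDiff_const)
    exact (h3.inv hw0).smul ((h1.smul contDiff_const).add (h2.smul contDiff_const))
  · have hAD : inner ℂ (A t) (Y - η • b) =
        ((1 - ‖b‖ ^ 2 : ℝ) : ℂ) * ((Real.sinh (s * t) : ℂ) + Real.cosh (s * t) * η) := by
      simp only [hA, inner_add_left, inner_sub_right, inner_smul_left, inner_smul_right, hη, hη',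
        hbb, hYY, Complex.conj_ofReal]
      push_cast at hηη ⊢
      linear_combination (-Complex.sinh (s * t)) * hηη
    have hd2 : HasDerivAt (deriv c) ((2 * (w t)⁻¹ * (-(s * ((Real.sinh (s * t) : ℂ)
        + Real.cosh (s * t) * η)) / w t ^ 2) * s) • (Y - η • b)) t := by
      rw [hdc]
      refine ((((hwd t).inv (hw0 t)).pow 2).mul_const (s : ℂ)).smul_const (Y - η • b)
        |>.congr_deriv ?_
      simp
    rw [covAlong, christoffel_metric (hcb t), hd2.deriv, hch]
    have hct : c t = (w t)⁻¹ • A t := rfl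
    have hww : ((‖w t‖ ^ 2 : ℝ) : ℂ) = star (w t) * w t := by
      rw [Complex.star_def, ← Complex.normSq_eq_conj_mul_self, Complex.normSq_eq_norm_sq]
    have hwt := hw0 t
    have hwt' : (starRingEnd ℂ) (w t) ≠ 0 := by simpa using hwt
    have hhc : ((1 - ‖b‖ ^ 2 : ℝ) : ℂ) ≠ 0 := Complex.ofReal_ne_zero.2 hh.ne'
    rw [hdc, Complex.ofReal_div, hww, hct]
    simp only [inner_smul_left, inner_smul_right, hAD, map_inv₀, Complex.star_def]
    rw [smul_smul, ← add_smul, ← add_smul]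
    convert zero_smul ℂ _
    field_simp
    ring
  · rw [(hcd 0).deriv]
    simp [hw]

/-- Reverse Cauchy–Schwarz for the lifts (1, b) and (1, q): 1 - Re⟨b, q⟩ is the mean of 1 - |b|² and
1 - |q|² plus |b - q|² / 2, and the arithmetic mean dominates the geometric one. -/
theorem mul_lt_norm_one_sub_inner_sq {b q : EuclideanSpace ℂ (Fin k)} (hb : b ∈ ball k)
    (hq : q ∈ ball k) (hne : q ≠ b) :
    (1 - ‖b‖ ^ 2) * (1 - ‖q‖ ^ 2) < ‖1 - (inner ℂ b q : ℂ)‖ ^ 2 := by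
  have h1 := one_sub_norm_sq_pos hb
  have h2 := one_sub_norm_sq_pos hq
  have h3 : 0 < ‖b - q‖ ^ 2 := pow_pos (norm_pos_iff.2 (sub_ne_zero.2 hne.symm)) 2
  have h4 : ‖b - q‖ ^ 2 = ‖b‖ ^ 2 - 2 * (inner ℂ b q : ℂ).re + ‖q‖ ^ 2 :=
    norm_sub_sq (𝕜 := ℂ) b q
  have h5 : 1 - (inner ℂ b q : ℂ).re ≤ ‖1 - (inner ℂ b q : ℂ)‖ := by
    simpa using Complex.re_le_norm (1 - (inner ℂ b q : ℂ))
  have h6 : ((1 - ‖b‖ ^ 2) + (1 - ‖q‖ ^ 2) + ‖b - q‖ ^ 2) / 2 ≤ ‖1 - (inner ℂ b q : ℂ)‖ := by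
    linarith
  have h7 := pow_le_pow_left₀ (by positivity) h6 2
  nlinarith [sq_nonneg (‖b‖ ^ 2 - ‖q‖ ^ 2)]

/-- The lift (1, q) is rescaled to l (1, q), with the same norm as (1, b) and with real product with
it. Solving l (1, q) = cosh s (1, b) + sinh s (η, Y) for (η, Y) provides the data of
`isGeodesic_of_lorentz`. -/
theorem exists_isGeodesic {b q : EuclideanSpace ℂ (Fin k)} (hb : b ∈ ball k) (hq : q ∈ ball k) :
    ∃ c, IsGeodesic (ball k) (metric k) c ∧ c 0 = b ∧ c 1 = q ∧
      ∃ l : ℂ, deriv c 0 = l • (q - b) := by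
  rcases eq_or_ne q b with rfl | hne
  · refine ⟨fun _ => q, ⟨contDiff_const, fun t => ⟨hq, ?_⟩⟩, rfl, rfl, 0, by simp⟩
    rw [covAlong, christoffel_metric hq]
    simp
  have h1 := one_sub_norm_sq_pos hb
  have h2 := one_sub_norm_sq_pos hq
  have h3 := mul_lt_norm_one_sub_inner_sq hb hq hne
  have h12 := mul_pos h1 h2
  set z : ℂ := 1 - inner ℂ b q with hz
  have hz0 : z ≠ 0 := by
    intro h
    rw [h] at h3
    norm_num at h3
    linarith
  set C : ℝ := Real.sqrt (‖z‖ ^ 2 / ((1 - ‖b‖ ^ 2) * (1 - ‖q‖ ^ 2))) with hC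
  have hC2 : C ^ 2 = ‖z‖ ^ 2 / ((1 - ‖b‖ ^ 2) * (1 - ‖q‖ ^ 2)) := Real.sq_sqrt (by positivity)
  have hC1 : 1 < C := by
    rw [hC]
    refine Real.lt_sqrt_of_sq_lt ?_
    rw [one_pow, one_lt_div h12]
    exact h3
  obtain ⟨s, hs0, hs⟩ : ∃ s, Real.sinh s ≠ 0 ∧ Real.cosh s = C := by
    refine ⟨Real.arcosh C, ?_, Real.cosh_arcosh hC1.le⟩
    intro h
    have h4 := Real.cosh_sq_sub_sinh_sq (Real.arcosh C)
    rw [h, Real.cosh_arcosh hC1.le] at h4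
    nlinarith
  set S : ℝ := Real.sinh s
  have hCS : C ^ 2 - S ^ 2 = 1 := by rw [← hs]; exact Real.cosh_sq_sub_sinh_sq s
  -- The phase of `l` makes `l * z` real; its modulus gives the two lifts equal norm, which is
  -- `hln`.
  set l : ℂ := C * (1 - ‖b‖ ^ 2 : ℝ) / z with hl
  have hlz : l * z = C * (1 - ‖b‖ ^ 2 : ℝ) := div_mul_cancel₀ _ hz0
  have hln : ‖l‖ ^ 2 * (1 - ‖q‖ ^ 2) = 1 - ‖b‖ ^ 2 := by
    have hzn : ‖z‖ ≠ 0 := norm_ne_zero_iff.2 hz0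
    rw [hl, norm_div, norm_mul, div_pow, mul_pow, Complex.norm_real, Complex.norm_real,
      Real.norm_eq_abs, Real.norm_eq_abs, sq_abs, sq_abs, hC2]
    field_simp
  have hSc : (S : ℂ) ≠ 0 := Complex.ofReal_ne_zero.2 hs0
  set Y : EuclideanSpace ℂ (Fin k) := (S : ℂ)⁻¹ • (l • q - (C : ℂ) • b) with hYdef
  set η : ℂ := (S : ℂ)⁻¹ * (l - C) with hηdef
  have hbb : (inner ℂ b b : ℂ) = ((‖b‖ ^ 2 : ℝ) : ℂ) := by
    rw [inner_self_eq_norm_sq_to_K]; simp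
  have hbq : (inner ℂ b q : ℂ) = 1 - z := by rw [hz]; ring
  have hη : inner ℂ b Y = η := by
    rw [hYdef, inner_smul_right, inner_sub_right, inner_smul_right, inner_smul_right, hbb, hbq,
      hηdef]
    congr 1
    push_cast at hlz ⊢
    linear_combination -hlz
  have hY : ‖Y‖ ^ 2 - ‖η‖ ^ 2 = 1 - ‖b‖ ^ 2 := by
    have e1 : ‖l • q - (C : ℂ) • b‖ ^ 2 = ‖l‖ ^ 2 * ‖q‖ ^ 2
        - 2 * (C * (l * (1 - z)).re) + C ^ 2 * ‖b‖ ^ 2 := by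
      have h := norm_sub_sq (𝕜 := ℂ) (l • q) ((C : ℂ) • b)
      rw [norm_smul, norm_smul, inner_re_symm, inner_smul_left, inner_smul_right, hbq,
        Complex.conj_ofReal, Complex.norm_real, Real.norm_eq_abs, mul_pow, mul_pow, sq_abs] at h
      rw [h]
      simp
    have e2 : ‖l - (C : ℂ)‖ ^ 2 = ‖l‖ ^ 2 - 2 * (C * l.re) + C ^ 2 := by
      rw [← Complex.normSq_eq_norm_sq, ← Complex.normSq_eq_norm_sq, Complex.normSq_apply,
        Complex.normSq_apply]
      simp
      ring
    have e3 : (l * (1 - z)).re = l.re - C * (1 - ‖b‖ ^ 2) := by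
      rw [mul_sub, hlz, mul_one, ← Complex.ofReal_mul, Complex.sub_re, Complex.ofReal_re]
    rw [hYdef, hηdef, norm_smul, norm_mul, mul_pow, mul_pow, e1, e2, e3, norm_inv,
      Complex.norm_real, Real.norm_eq_abs, inv_pow, sq_abs]
    have hS2 : S ^ 2 = C ^ 2 - 1 := by linarith
    have hS2' : S ^ 2 ≠ 0 := pow_ne_zero 2 hs0
    field_simp
    rw [hS2]
    linear_combination -hln
  obtain ⟨hg, hd⟩ := isGeodesic_of_lorentz hb hη hY s
  refine ⟨_, hg, ?_, ?_, s * ((S : ℂ)⁻¹ * l), ?_⟩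
  · simp
  · have hl0 : l ≠ 0 := by
      intro h
      rw [h, norm_zero] at hln
      linarith
    have e1 : (C : ℂ) + S * η = l := by rw [hηdef]; field_simp; ring
    have e2 : (C : ℂ) • b + (S : ℂ) • Y = l • q := by
      rw [hYdef, smul_smul, mul_inv_cancel₀ hSc]; module
    simp only [mul_one, hs]
    change ((C : ℂ) + S * η)⁻¹ • ((C : ℂ) • b + (S : ℂ) • Y) = q
    rw [e1, e2, smul_smul, inv_mul_cancel₀ hl0, one_smul]
  · rw [hd, hYdef, hηdef]
    module

theorem expImage_submodule {b : EuclideanSpace ℂ (Fin k)} (hb : b ∈ ball k)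
    (S : Submodule ℂ (EuclideanSpace ℂ (Fin k))) :
    expImage (ball k) (metric k) b S = slice b S := by
  ext q
  constructor
  · rintro ⟨c, hc, h0, hS, rfl⟩
    refine ⟨(hc.2 1).1, ?_⟩
    rw [← h0]
    exact sub_mem_of_deriv_mem (hc.1.differentiable (by simp)) (IsGeodesic.deriv_mem hc hS) 1 0
  · rintro ⟨hq, hS⟩
    obtain ⟨c, hc, h0, h1, l, hl⟩ := exists_isGeodesic hb hq
    exact ⟨c, hc, h0, by rw [hl]; exact S.smul_mem l hS, h1⟩

theorem IsComplexPlane.exists_eq_slice {E : Set (EuclideanSpace ℂ (Fin k))}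
    (hE : IsComplexPlane k E) : ∃ b ∈ ball k, ∃ u ≠ 0, E = slice b (Submodule.span ℂ {u}) := by
  obtain ⟨b, hb, u, v, hu, hv, huv, hR, rfl⟩ := hE
  have hu0 : u ≠ 0 := by rintro rfl; simp at hu
  refine ⟨b, hb, u, hu0, ?_⟩
  rw [← expImage_submodule hb]
  congr 1
  set s : ℝ := (herm b u v).im with hs
  have hH : herm b u v = s * Complex.I := by
    apply Complex.ext
    · simpa [← metric_eq_re_herm] using huv
    · simp [hs]
  -- With h(u, v) = si and h(u, u) = 1 the eigenvalue equation reads -3si u - v = -4v, which forces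
  -- v = si u.
  have hv' : v = (s * Complex.I : ℂ) • u := by
    rw [curvature_metric hb, ← herm_conj_symm b u v, herm_self, hu, hH] at hR
    simp only [Complex.star_def, map_mul, Complex.conj_ofReal, Complex.conj_I, Complex.ofReal_one,
      one_smul] at hR
    have h3 : (3 : ℂ) • v = (3 : ℂ) • ((s * Complex.I : ℂ) • u) := by
      have h4 : (-4 : ℝ) • v = (-4 : ℂ) • v := by
        rw [← Complex.coe_smul]; norm_num
      rw [h4] at hR
      linear_combination (norm := module) hR
    exact smul_right_injective _ (by norm_num : (3 : ℂ) ≠ 0) h3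
  have hs0 : s ≠ 0 := by
    intro h
    rw [hv', h] at hv
    simp at hv
  ext x
  simp only [SetLike.mem_coe, Submodule.mem_span_pair, Submodule.mem_span_singleton]
  constructor
  · rintro ⟨α, β, rfl⟩
    refine ⟨α + β * (s * Complex.I), ?_⟩
    rw [hv', add_smul, mul_smul, Complex.coe_smul, Complex.coe_smul]
  · rintro ⟨z, rfl⟩
    refine ⟨z.re, z.im / s, ?_⟩
    rw [hv', ← Complex.coe_smul, ← Complex.coe_smul, smul_smul, ← add_smul]
    congr 1
    have hsc : (s : ℂ) ≠ 0 := Complex.ofReal_ne_zero.2 hs0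
    rw [Complex.ofReal_div]
    field_simp
    exact Complex.re_add_im z

/-! ### Tangent and normal spaces of slices -/

theorem tangentDirs_slice {a : EuclideanSpace ℂ (Fin k)} (ha : a ∈ ball k)
    (S : Submodule ℂ (EuclideanSpace ℂ (Fin k))) : tangentDirs (slice a S) a = S := by
  ext x
  constructor
  · rintro ⟨c, hc, hE, h0, rfl⟩
    set P : EuclideanSpace ℂ (Fin k) →L[ℝ] EuclideanSpace ℂ (Fin k) :=
      S.starProjection.restrictScalars ℝ with hP
    have hPS : ∀ v, P v = v ↔ v ∈ S := fun v => S.starProjection_eq_self_iff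
    have h1 := ((hc.differentiableAt (by simp)).hasDerivAt).sub_const a
    have h2 := P.hasFDerivAt.comp_hasDerivAt 0 h1
    have h3 : (fun t => c t - a) =ᶠ[𝓝 0] P ∘ fun t => c t - a := by
      filter_upwards [hE] with t ht
      exact ((hPS _).2 ht.2).symm
    exact (hPS _).1 (h2.unique (h1.congr_of_eventuallyEq h3.symm))
  · intro hx
    refine ⟨fun t => a + t • x, ?_, ?_, by simp, (hasDerivAt_add_smul a x 0).deriv⟩
    · exact (contDiff_const.add (contDiff_id.smul contDiff_const)).contDiffAt
    · have h1 : Tendsto (fun t : ℝ => a + t • x) (𝓝 0) (𝓝 a) := by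
        simpa using (hasDerivAt_add_smul a x 0).continuousAt.tendsto
      filter_upwards [h1.eventually ((isOpen_ball k).mem_nhds ha)] with t ht
      refine ⟨ht, ?_⟩
      rw [add_sub_cancel_left, ← Complex.coe_smul]
      exact S.smul_mem _ hx

/-- Real orthogonality to a complex subspace is Hermitian orthogonality: testing against ix recovers
the imaginary part. -/
theorem mem_normalSpace_slice {a : EuclideanSpace ℂ (Fin k)} (ha : a ∈ ball k)
    {S : Submodule ℂ (EuclideanSpace ℂ (Fin k))} {z : EuclideanSpace ℂ (Fin k)} :
    z ∈ normalSpace (metric k) (slice a S) a ↔ ∀ x ∈ S, herm a x z = 0 := by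
  rw [normalSpace, tangentDirs_slice ha]
  simp only [metric_eq_re_herm, mem_ofPred_eq, SetLike.mem_coe]
  refine ⟨fun h x hx => Complex.ext (h x hx) ?_, fun h x hx => by simp [h x hx]⟩
  have h1 := h _ (S.smul_mem Complex.I hx)
  rw [herm_smul_left] at h1
  simpa using h1

theorem metric_symm (p u v : EuclideanSpace ℂ (Fin k)) : metric k p u v = metric k p v u := by
  rw [metric_eq_re_herm, metric_eq_re_herm, ← herm_conj_symm p u v]
  simp

/-! ### Parallel translation along loops in a slice -/

theorem mem_ball_of_loop {a : EuclideanSpace ℂ (Fin k)}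
    {S : Submodule ℂ (EuclideanSpace ℂ (Fin k))} {c : ℝ → EuclideanSpace ℂ (Fin k)}
    (hc : IsPiecewiseSmoothLoop (slice a S) a c) {t : ℝ} (ht : t ∈ Icc (0 : ℝ) 1) : c t ∈ ball k :=
  (hc.2.1 t ht).1

theorem exists_finset_contDiffAt {V : Type*} [NormedAddCommGroup V] [NormedSpace ℝ V] {E : Set V}
    {a : V} {c : ℝ → V} (hc : IsPiecewiseSmoothLoop E a c) :
    ∃ F : Finset ℝ, ∀ t ∈ Ioo (0 : ℝ) 1, t ∉ F → ContDiffAt ℝ ∞ c t := by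
  classical
  obtain ⟨-, -, -, -, n, τ, hmono, h0, h1, hsm⟩ := hc
  refine ⟨(Finset.range (n + 1)).image τ, fun t ht htF => ?_⟩
  -- The first breakpoint beyond `t` locates the piece whose interior contains `t`.
  have hex : ∃ j, t < τ j := ⟨n, by rw [h1]; exact ht.2⟩
  have hlt := Nat.find_spec hex
  have hle : Nat.find hex ≤ n := Nat.find_min' hex (by rw [h1]; exact ht.2)
  obtain ⟨i, hi⟩ : ∃ i, Nat.find hex = i + 1 := by
    refine Nat.exists_eq_succ_of_ne_zero fun h => ?_
    rw [h, h0] at hlt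
    exact hlt.not_gt ht.1
  rw [hi] at hlt hle
  have hge : τ i ≤ t := not_lt.1 (Nat.find_min hex (by omega))
  have hne : τ i ≠ t := fun h =>
    htF (Finset.mem_image.2 ⟨i, Finset.mem_range.2 (by omega), h⟩)
  exact (hsm i (by omega)).contDiffAt (Icc_mem_nhds (lt_of_le_of_ne hge hne) hlt)

/-- The coefficient of the differential equation of parallel translation of normal vectors. -/
noncomputable def transportRate (c : ℝ → EuclideanSpace ℂ (Fin k)) (t : ℝ) : ℂ :=
  inner ℂ (c t) (deriv c t) / (1 - ‖c t‖ ^ 2 : ℝ)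

theorem intervalIntegrable_transportRate {a : EuclideanSpace ℂ (Fin k)}
    {S : Submodule ℂ (EuclideanSpace ℂ (Fin k))} {c : ℝ → EuclideanSpace ℂ (Fin k)}
    (hc : IsPiecewiseSmoothLoop (slice a S) a c) :
    IntervalIntegrable (transportRate c) MeasureTheory.volume 0 1 := by
  obtain ⟨-, hE, -, -, n, τ, hmono, h0, h1, hsm⟩ := hc
  rw [← h0, ← h1]
  refine IntervalIntegrable.trans_iterate fun i hi => ?_
  -- The breakpoints are only weakly increasing, so a piece may degenerate to a point. On a genuine
  -- piece the one-sided derivative supplies a continuous integrand agreeing with the rate in the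
  -- interior.
  rcases (hmono i.le_succ).eq_or_lt with h | h
  · rw [Nat.succ_eq_add_one] at h
    rw [h]
  have hsub : ∀ t ∈ Icc (τ i) (τ (i + 1)), c t ∈ ball k := fun t ht =>
    (hE t ⟨h0 ▸ (hmono (Nat.zero_le i)).trans ht.1, h1 ▸ ht.2.trans (hmono hi)⟩).1
  have hcont : ContinuousOn (fun t => (inner ℂ (c t) (derivWithin c (Icc (τ i) (τ (i + 1))) t) /
      (1 - ‖c t‖ ^ 2 : ℝ) : ℂ)) (Icc (τ i) (τ (i + 1))) := by
    have e1 := (hsm i hi).continuousOn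
    have e2 := (hsm i hi).continuousOn_derivWithin (uniqueDiffOn_Icc h) (by simp)
    refine (e1.inner e2).div (Complex.continuous_ofReal.comp_continuousOn
      (continuousOn_const.sub (e1.norm.pow 2))) fun t ht => ?_
    exact Complex.ofReal_ne_zero.2 (one_sub_norm_sq_pos (hsub t ht)).ne'
  rw [← uIcc_of_le h.le] at hcont
  refine hcont.intervalIntegrable.congr_uIoo fun t ht => ?_
  rw [uIoo_of_le h.le] at ht
  simp only [transportRate, uIcc_of_le h.le]
  rw [derivWithin_of_mem_nhds (Icc_mem_nhds ht.1 ht.2)]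

theorem continuousAt_transportRate {c : ℝ → EuclideanSpace ℂ (Fin k)} {t : ℝ}
    (hc : ContDiffAt ℝ ∞ c t) (ht : c t ∈ ball k) : ContinuousAt (transportRate c) t := by
  have h1 : ContinuousAt (deriv c) t := by
    have h2 := (hc.continuousAt_fderiv (by simp)).clm_apply (continuousAt_const (y := (1 : ℝ)))
    simpa using h2
  refine (hc.continuousAt.inner h1).div (Complex.continuous_ofReal.continuousAt.comp
    (continuousAt_const.sub (hc.continuousAt.norm.pow 2))) ?_
  exact Complex.ofReal_ne_zero.2 (one_sub_norm_sq_pos ht).ne'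

theorem hasDerivAt_integral_transportRate {a : EuclideanSpace ℂ (Fin k)}
    {S : Submodule ℂ (EuclideanSpace ℂ (Fin k))} {c : ℝ → EuclideanSpace ℂ (Fin k)}
    (hc : IsPiecewiseSmoothLoop (slice a S) a c) {F : Finset ℝ}
    (hF : ∀ t ∈ Ioo (0 : ℝ) 1, t ∉ F → ContDiffAt ℝ ∞ c t) {t : ℝ} (ht : t ∈ Ioo (0 : ℝ) 1)
    (htF : t ∉ F) :
    HasDerivAt (fun t => ∫ s in (0 : ℝ)..t, transportRate c s) (transportRate c t) t := by
  have hcont : ∀ s ∈ Ioo (0 : ℝ) 1 \ F, ContinuousAt (transportRate c) s := fun s hs =>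
    continuousAt_transportRate (hF s hs.1 hs.2) (mem_ball_of_loop hc (Ioo_subset_Icc_self hs.1))
  have hmem : t ∈ Ioo (0 : ℝ) 1 \ F := ⟨ht, htF⟩
  refine intervalIntegral.integral_hasDerivAt_right ?_
    (ContinuousAt.stronglyMeasurableAtFilter (isOpen_Ioo.sdiff F.finite_toSet.isClosed) hcont t
      hmem) (hcont t hmem)
  refine (intervalIntegrable_transportRate hc).mono_set ?_
  rw [uIcc_of_le ht.1.le, uIcc_of_le zero_le_one]
  exact Icc_subset_Icc_right ht.2.le

/-- Metric compatibility: in the Koszul formula for g(Γ(c', W), W) the last two terms cancel, so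
g(W, W) has zero derivative off a finite set. -/
theorem norm_const_of_isParallelAlong {a : EuclideanSpace ℂ (Fin k)}
    {S : Submodule ℂ (EuclideanSpace ℂ (Fin k))} {c W : ℝ → EuclideanSpace ℂ (Fin k)}
    (hc : IsPiecewiseSmoothLoop (slice a S) a c) (hW : IsParallelAlong (metric k) c W) :
    metric k a (W 1) (W 1) = metric k a (W 0) (W 0) := by
  classical
  obtain ⟨F, hF⟩ := exists_finset_contDiffAt hc
  obtain ⟨hWc, G, hG⟩ := hW
  have hcont : ContinuousOn (fun t => metric k (c t) (W t) (W t)) (uIcc 0 1) := by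
    rw [uIcc_of_le zero_le_one]
    exact (((contDiffOn_metric k).continuousOn.comp hc.1 fun t ht =>
      mem_ball_of_loop hc ht).clm_apply hWc).clm_apply hWc
  have h := MeasureTheory.integral_eq_of_hasDerivAt_off_countable
    (fun t => metric k (c t) (W t) (W t)) (fun _ => 0) (a := 0) (b := 1)
    (s := ((F ∪ G : Finset ℝ) : Set ℝ)) (Finset.countable_toSet _) hcont ?_ (by simp)
  · rw [intervalIntegral.integral_zero, hc.2.2.1, hc.2.2.2.1] at h
    linarith
  · rintro t ⟨ht, htFG⟩
    rw [min_eq_left zero_le_one, max_eq_right zero_le_one] at ht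
    rw [Finset.coe_union, mem_union, not_or] at htFG
    have htb := mem_ball_of_loop hc (Ioo_subset_Icc_self ht)
    obtain ⟨hWd, hcov⟩ := hG t ht htFG.2
    have hd := hasDerivAt_metric_along (differentiableAt_metric htb)
      ((hF t ht htFG.1).differentiableAt (by simp)).hasDerivAt hWd.hasDerivAt hWd.hasDerivAt
    refine hd.congr_deriv ?_
    have hk := metric_christoffel (metric k) (c t) (metric_isInvertible k _ htb) (deriv c t) (W t)
      (W t)
    rw [covAlong] at hcov
    rw [metric_symm _ (W t) (deriv W t), eq_neg_of_add_eq_zero_left hcov, map_neg,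
      neg_apply, hk]
    ring

theorem IsParallelAlong.sub {a : EuclideanSpace ℂ (Fin k)}
    {S : Submodule ℂ (EuclideanSpace ℂ (Fin k))} {c W X : ℝ → EuclideanSpace ℂ (Fin k)}
    (hc : IsPiecewiseSmoothLoop (slice a S) a c) (hW : IsParallelAlong (metric k) c W)
    (hX : IsParallelAlong (metric k) c X) : IsParallelAlong (metric k) c (W - X) := by
  classical
  obtain ⟨hWc, G, hG⟩ := hW
  obtain ⟨hXc, H, hH⟩ := hX
  refine ⟨hWc.sub hXc, G ∪ H, fun t ht htGH => ?_⟩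
  rw [Finset.mem_union, not_or] at htGH
  obtain ⟨hWd, hW⟩ := hG t ht htGH.1
  obtain ⟨hXd, hX⟩ := hH t ht htGH.2
  refine ⟨hWd.sub hXd, ?_⟩
  have htb := mem_ball_of_loop hc (Ioo_subset_Icc_self ht)
  rw [covAlong, christoffel_metric htb] at hW hX ⊢
  rw [deriv_sub hWd hXd, Pi.sub_apply, inner_sub_right, eq_neg_of_add_eq_zero_left hW,
    eq_neg_of_add_eq_zero_left hX, sub_div]
  module

/-- The difference of two parallel fields is parallel, starts at 0 and has constant norm. -/
theorem ParallelTranslate.unique {a : EuclideanSpace ℂ (Fin k)} (ha : a ∈ ball k)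
    {S : Submodule ℂ (EuclideanSpace ℂ (Fin k))} {c : ℝ → EuclideanSpace ℂ (Fin k)}
    (hc : IsPiecewiseSmoothLoop (slice a S) a c) {v w w' : EuclideanSpace ℂ (Fin k)}
    (h : ParallelTranslate (metric k) c v w) (h' : ParallelTranslate (metric k) c v w') :
    w = w' := by
  obtain ⟨W, hW, hW0, rfl⟩ := h
  obtain ⟨X, hX, hX0, rfl⟩ := h'
  have h := norm_const_of_isParallelAlong hc (IsParallelAlong.sub hc hW hX)
  rw [Pi.sub_apply, Pi.sub_apply, hW0, hX0, sub_self, map_zero] at h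
  by_contra hne
  exact (metric_pos k a _ ha (sub_ne_zero.2 hne)).ne' h

theorem ParallelTranslate.metric_eq {a : EuclideanSpace ℂ (Fin k)}
    {S : Submodule ℂ (EuclideanSpace ℂ (Fin k))} {c : ℝ → EuclideanSpace ℂ (Fin k)}
    (hc : IsPiecewiseSmoothLoop (slice a S) a c) {v w : EuclideanSpace ℂ (Fin k)}
    (h : ParallelTranslate (metric k) c v w) : metric k a w w = metric k a v v := by
  obtain ⟨W, hW, rfl, rfl⟩ := h
  exact norm_const_of_isParallelAlong hc hW

/-- The field Z(p) = z + β (p - a) is the projection of the constant vector (-β, z - β a) of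
ℂ^{1,k}, which is orthogonal to the lifts (1, p) of all points of the slice. The formula expresses
this orthogonality. -/
theorem inner_normal_extension {a p z : EuclideanSpace ℂ (Fin k)} (ha : a ∈ ball k)
    {S : Submodule ℂ (EuclideanSpace ℂ (Fin k))} (hp : p - a ∈ S)
    (hz : ∀ x ∈ S, herm a x z = 0) :
    inner ℂ p (z + (-(inner ℂ a z / (1 - ‖a‖ ^ 2 : ℝ)) : ℂ) • (p - a)) =
      (inner ℂ a z / (1 - ‖a‖ ^ 2 : ℝ)) * ((1 - ‖p‖ ^ 2 : ℝ) : ℂ) := by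
  have hh : ((1 - ‖a‖ ^ 2 : ℝ) : ℂ) ≠ 0 := Complex.ofReal_ne_zero.2 (one_sub_norm_sq_pos ha).ne'
  have hpp : (inner ℂ p p : ℂ) = ((‖p‖ ^ 2 : ℝ) : ℂ) := by
    rw [inner_self_eq_norm_sq_to_K]; simp
  have haa : (inner ℂ a a : ℂ) = ((‖a‖ ^ 2 : ℝ) : ℂ) := by
    rw [inner_self_eq_norm_sq_to_K]; simp
  have h1 := hz _ hp
  simp only [herm, inner_sub_left, haa] at h1
  rw [inner_add_right, inner_smul_right, inner_sub_right, hpp]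
  push_cast at hh h1 ⊢
  field_simp at h1 ⊢
  linear_combination h1

/-- In Γ(c', Z) the term ⟨c, Z⟩ c' / (1 - |c|²) equals -β c' and cancels Z' = β c'. What remains is
a multiple of Z by the rate, removed by the exponential factor. -/
theorem parallelTranslate_of_normal {a z : EuclideanSpace ℂ (Fin k)} (ha : a ∈ ball k)
    {S : Submodule ℂ (EuclideanSpace ℂ (Fin k))} {c : ℝ → EuclideanSpace ℂ (Fin k)}
    (hc : IsPiecewiseSmoothLoop (slice a S) a c) (hz : ∀ x ∈ S, herm a x z = 0) :
    ParallelTranslate (metric k) c z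
      (Complex.exp (-∫ s in (0 : ℝ)..1, transportRate c s) • z) := by
  obtain ⟨F, hF⟩ := exists_finset_contDiffAt hc
  set β : ℂ := -(inner ℂ a z / (1 - ‖a‖ ^ 2 : ℝ)) with hβ
  refine ⟨fun t => Complex.exp (-∫ s in (0 : ℝ)..t, transportRate c s) • (z + β • (c t - a)),
    ⟨?_, F, fun t ht htF => ?_⟩, ?_, ?_⟩
  · have h1 := intervalIntegral.continuousOn_primitive_interval'
      (intervalIntegrable_transportRate hc) left_mem_uIcc
    rw [uIcc_of_le zero_le_one] at h1
    exact (h1.neg.cexp).smul (continuousOn_const.add ((hc.1.sub continuousOn_const).const_smul β))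
  · have htb := mem_ball_of_loop hc (Ioo_subset_Icc_self ht)
    have hcd := ((hF t ht htF).differentiableAt (by simp)).hasDerivAt
    have hd := ((hasDerivAt_integral_transportRate hc hF ht htF).fun_neg.cexp).fun_smul
      (((hcd.sub_const a).fun_const_smul β).const_add z)
    refine ⟨hd.differentiableAt, ?_⟩
    have h1 := inner_normal_extension ha (hc.2.1 t (Ioo_subset_Icc_self ht)).2 hz
    rw [← hβ] at h1
    have hh : ((1 - ‖c t‖ ^ 2 : ℝ) : ℂ) ≠ 0 :=
      Complex.ofReal_ne_zero.2 (one_sub_norm_sq_pos htb).ne'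
    have h2 : (inner ℂ a z / (1 - ‖a‖ ^ 2 : ℝ) : ℂ) = -β := by rw [hβ, neg_neg]
    rw [covAlong, hd.deriv, christoffel_metric htb, inner_smul_right, h1, h2, ← mul_assoc,
      mul_div_assoc, div_self hh, transportRate]
    module
  · simp [hc.2.2.1]
  · simp [hc.2.2.2.1]

theorem parallelTranslate_iff {a z w : EuclideanSpace ℂ (Fin k)} (ha : a ∈ ball k)
    {S : Submodule ℂ (EuclideanSpace ℂ (Fin k))} {c : ℝ → EuclideanSpace ℂ (Fin k)}
    (hc : IsPiecewiseSmoothLoop (slice a S) a c) (hz : ∀ x ∈ S, herm a x z = 0) :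
    ParallelTranslate (metric k) c z w ↔
      w = Complex.exp (-∫ s in (0 : ℝ)..1, transportRate c s) • z := by
  refine ⟨fun h => ParallelTranslate.unique ha hc h (parallelTranslate_of_normal ha hc hz), ?_⟩
  rintro rfl
  exact parallelTranslate_of_normal ha hc hz

/-- A nonzero complex scalar preserves `T` and the normal space, and metric compatibility keeps
lengths. The inverse scalar gives surjectivity. -/
theorem holonomy_image_fiber {a : EuclideanSpace ℂ (Fin k)} (ha : a ∈ ball k)
    {S T : Submodule ℂ (EuclideanSpace ℂ (Fin k))} {c : ℝ → EuclideanSpace ℂ (Fin k)}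
    (hc : IsPiecewiseSmoothLoop (slice a S) a c) :
    {w | ∃ z ∈ (T : Set (EuclideanSpace ℂ (Fin k))) ∩
        unitNormalSphere (metric k) (slice a S) a, ParallelTranslate (metric k) c z w} =
      (T : Set (EuclideanSpace ℂ (Fin k))) ∩ unitNormalSphere (metric k) (slice a S) a := by
  set m := Complex.exp (-∫ s in (0 : ℝ)..1, transportRate c s) with hm
  have hm0 : m ≠ 0 := Complex.exp_ne_zero _
  have hN : ∀ {z} (l : ℂ), z ∈ normalSpace (metric k) (slice a S) a →
      l • z ∈ normalSpace (metric k) (slice a S) a := by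
    intro z l hz
    rw [mem_normalSpace_slice ha] at hz ⊢
    intro x hx
    rw [herm_smul_right, hz x hx, mul_zero]
  ext w
  constructor
  · rintro ⟨z, ⟨hzT, hzN, hz1⟩, hPT⟩
    have hPT' := hPT
    rw [parallelTranslate_iff ha hc ((mem_normalSpace_slice ha).1 hzN)] at hPT
    refine ⟨hPT ▸ T.smul_mem _ hzT, hPT ▸ hN _ hzN, ?_⟩
    rw [ParallelTranslate.metric_eq hc hPT', hz1]
  · rintro ⟨hwT, hwN, hw1⟩
    have hPT : ParallelTranslate (metric k) c (m⁻¹ • w) w := by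
      rw [parallelTranslate_iff ha hc ((mem_normalSpace_slice ha).1 (hN _ hwN)), ← hm, smul_smul,
        mul_inv_cancel₀ hm0, one_smul]
    refine ⟨m⁻¹ • w, ⟨T.smul_mem _ hwT, hN _ hwN, ?_⟩, hPT⟩
    rw [← ParallelTranslate.metric_eq hc hPT, hw1]

/-! ### Nontrivial holonomy along small circles -/

/-- The new base point is the point of the complex line nearest the origin; there ⟨a, e⟩ = 0, which
makes the holonomy integrand explicit. -/
theorem exists_unit_orthogonal_base {b u : EuclideanSpace ℂ (Fin k)} (hb : b ∈ ball k)
    (hu : u ≠ 0) : ∃ a e : EuclideanSpace ℂ (Fin k), a ∈ ball k ∧ ‖e‖ = 1 ∧ inner ℂ a e = 0 ∧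
      slice b (Submodule.span ℂ {u}) = slice a (Submodule.span ℂ {e}) := by
  set S := Submodule.span ℂ {u} with hS
  have hun : (‖u‖ : ℂ) ≠ 0 := Complex.ofReal_ne_zero.2 (norm_ne_zero_iff.2 hu)
  have huS : u ∈ S := Submodule.mem_span_singleton_self u
  have ha : Sᗮ.starProjection b ∈ ball k := by
    rw [ball, mem_ball_zero_iff] at hb ⊢
    exact (Submodule.norm_starProjection_apply_le _ b).trans_lt hb
  have hab : Sᗮ.starProjection b - b ∈ S := by
    have h := Submodule.sub_starProjection_mem_orthogonal (K := Sᗮ) b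
    rw [Submodule.orthogonal_orthogonal] at h
    rw [← neg_sub]
    exact S.neg_mem h
  have heS : (‖u‖ : ℂ)⁻¹ • u ∈ S := S.smul_mem _ huS
  refine ⟨Sᗮ.starProjection b, (‖u‖ : ℂ)⁻¹ • u, ha, ?_, ?_, ?_⟩
  · rw [norm_smul, norm_inv, Complex.norm_real, norm_norm, inv_mul_cancel₀]
    exact norm_ne_zero_iff.2 hu
  · exact Submodule.inner_left_of_mem_orthogonal heS (Submodule.starProjection_apply_mem Sᗮ b)
  · rw [slice_eq_of_mem ⟨ha, hab⟩,
      Submodule.span_singleton_smul_eq (IsUnit.mk0 _ (inv_ne_zero hun))]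

/-- As ⟨a, e⟩ = 0, Euclidean orthogonality to `e` already implies orthogonality for the metric at
`a`. -/
theorem exists_normal_ne_zero (hk : 2 ≤ k) {a e : EuclideanSpace ℂ (Fin k)} (hae : inner ℂ a e = 0) :
    ∃ z ≠ 0, ∀ x ∈ Submodule.span ℂ {e}, herm a x z = 0 := by
  have hne : (Submodule.span ℂ {e})ᗮ ≠ ⊥ := by
    rw [Ne, Submodule.orthogonal_eq_bot_iff]
    intro h
    have h1 := finrank_span_le_card (R := ℂ) ({e} : Set (EuclideanSpace ℂ (Fin k)))
    rw [h, finrank_top, finrank_euclideanSpace_fin] at h1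
    simp at h1
    omega
  obtain ⟨z, hz, hz0⟩ := Submodule.exists_mem_ne_zero_of_ne_bot hne
  refine ⟨z, hz0, fun x hx => ?_⟩
  obtain ⟨l, rfl⟩ := Submodule.mem_span_singleton.1 hx
  have h1 := Submodule.mem_orthogonal_singleton_iff_inner_right.1 hz
  rw [herm_smul_left, herm, h1, ← inner_conj_symm e a, hae]
  simp

/-- The circle of radius `r` through `a` and with center `a - r • e` in the complex line
through `a` in direction `e`. -/
noncomputable def circleLoop (a e : EuclideanSpace ℂ (Fin k)) (r : ℝ) (t : ℝ) :
    EuclideanSpace ℂ (Fin k) :=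
  a + ((r : ℂ) * (Complex.exp ((2 * Real.pi * t : ℝ) * Complex.I) - 1)) • e

theorem hasDerivAt_circleLoop (a e : EuclideanSpace ℂ (Fin k)) (r t : ℝ) :
    HasDerivAt (circleLoop a e r) (((r : ℂ) * (Complex.exp ((2 * Real.pi * t : ℝ) * Complex.I) *
      ((2 * Real.pi : ℝ) * Complex.I))) • e) t := by
  have h1 : HasDerivAt (fun t : ℝ => 2 * Real.pi * t) (2 * Real.pi) t := by
    simpa using (hasDerivAt_id t).const_mul (2 * Real.pi)
  exact ((((h1.ofReal_comp.mul_const Complex.I).cexp.sub_const 1).const_mul (r : ℂ)).smul_const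
    e).const_add a

theorem contDiff_circleLoop (a e : EuclideanSpace ℂ (Fin k)) (r : ℝ) :
    ContDiff ℝ ∞ (circleLoop a e r) := by
  have h1 : ContDiff ℝ ∞ fun t : ℝ => ((2 * Real.pi * t : ℝ) : ℂ) * Complex.I :=
    (Complex.ofRealCLM.contDiff.comp (contDiff_const.mul contDiff_id)).mul contDiff_const
  exact contDiff_const.add ((contDiff_const.mul (h1.cexp.sub contDiff_const)).smul contDiff_const)

theorem normSq_exp_sub_one (θ : ℝ) :
    ‖Complex.exp (θ * Complex.I) - 1‖ ^ 2 = 2 * (1 - Real.cos θ) := by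
  rw [← Complex.normSq_eq_norm_sq, Complex.normSq_apply, Complex.sub_re, Complex.sub_im,
    Complex.exp_ofReal_mul_I_re, Complex.exp_ofReal_mul_I_im]
  simp
  nlinarith [Real.sin_sq_add_cos_sq θ]

theorem one_sub_norm_circleLoop_sq {a e : EuclideanSpace ℂ (Fin k)} (he : ‖e‖ = 1)
    (hae : inner ℂ a e = 0) (r t : ℝ) :
    1 - ‖circleLoop a e r t‖ ^ 2 =
      1 - ‖a‖ ^ 2 - 2 * r ^ 2 * (1 - Real.cos (2 * Real.pi * t)) := by
  have h := norm_add_sq (𝕜 := ℂ) a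
    (((r : ℂ) * (Complex.exp ((2 * Real.pi * t : ℝ) * Complex.I) - 1)) • e)
  rw [circleLoop, h, inner_smul_right, hae, norm_smul, he, norm_mul, mul_one, mul_pow,
    normSq_exp_sub_one, Complex.norm_real, Real.norm_eq_abs, sq_abs]
  simp
  ring

theorem transportRate_circleLoop_im {a e : EuclideanSpace ℂ (Fin k)} (he : ‖e‖ = 1)
    (hae : inner ℂ a e = 0) (r t : ℝ) :
    (transportRate (circleLoop a e r) t).im =
      2 * Real.pi * r ^ 2 * (1 - Real.cos (2 * Real.pi * t)) /
        (1 - ‖a‖ ^ 2 - 2 * r ^ 2 * (1 - Real.cos (2 * Real.pi * t))) := by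
  have hee : (inner ℂ e e : ℂ) = 1 := by rw [inner_self_eq_norm_sq_to_K, he]; simp
  rw [transportRate, Complex.div_ofReal_im, one_sub_norm_circleLoop_sq he hae,
    (hasDerivAt_circleLoop a e r t).deriv]
  congr 1
  rw [circleLoop, inner_smul_right, inner_add_left, inner_smul_left, hae, hee]
  simp only [map_mul, map_sub, map_one, Complex.conj_ofReal, zero_add, mul_one, Complex.mul_im,
    Complex.mul_re, Complex.sub_im, Complex.sub_re, Complex.conj_re, Complex.conj_im,
    Complex.exp_ofReal_mul_I_re, Complex.exp_ofReal_mul_I_im, Complex.ofReal_re, Complex.ofReal_im,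
    Complex.I_re, Complex.I_im, Complex.one_re, Complex.one_im]
  linear_combination (2 * Real.pi * r ^ 2) * Real.sin_sq_add_cos_sq (2 * Real.pi * t)

/-- The exponential is 1 only if the integral lies in 2πiℤ, so an imaginary part strictly between 0
and 2π excludes it. -/
theorem exp_integral_transportRate_circleLoop_ne_one {a e : EuclideanSpace ℂ (Fin k)}
    (he : ‖e‖ = 1) (hae : inner ℂ a e = 0) {r : ℝ} (hr : 0 < r)
    (hra : 6 * r ^ 2 < 1 - ‖a‖ ^ 2)
    (hint : IntervalIntegrable (transportRate (circleLoop a e r)) MeasureTheory.volume 0 1) :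
    Complex.exp (-∫ s in (0 : ℝ)..1, transportRate (circleLoop a e r) s) ≠ 1 := by
  have hpi := Real.pi_pos
  have hr2 : 0 < r ^ 2 := pow_pos hr 2
  have hcos : ∀ t ∈ Ioo (0 : ℝ) 1, 0 < 1 - Real.cos (2 * Real.pi * t) := by
    intro t ht
    rw [sub_pos]
    refine lt_of_le_of_ne (Real.cos_le_one _) fun h => ?_
    rw [Real.cos_eq_one_iff_of_lt_of_lt (by nlinarith [ht.1]) (by nlinarith [ht.2])] at h
    exact (mul_pos (by positivity) ht.1).ne' h
  have hint' : IntervalIntegrable (fun t => (transportRate (circleLoop a e r) t).im)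
      MeasureTheory.volume 0 1 := ⟨hint.1.im, hint.2.im⟩
  have him : (∫ s in (0 : ℝ)..1, transportRate (circleLoop a e r) s).im =
      ∫ s in (0 : ℝ)..1, (transportRate (circleLoop a e r) s).im :=
    (Complex.imCLM.intervalIntegral_comp_comm hint).symm
  have hden : ∀ t, 4 * r ^ 2 < 1 - ‖a‖ ^ 2 → 0 < 1 - ‖a‖ ^ 2
      - 2 * r ^ 2 * (1 - Real.cos (2 * Real.pi * t)) := by
    intro t h
    nlinarith [Real.neg_one_le_cos (2 * Real.pi * t)]
  have h1 : 0 < ∫ s in (0 : ℝ)..1, (transportRate (circleLoop a e r) s).im := by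
    refine intervalIntegral.intervalIntegral_pos_of_pos_on hint' (fun t ht => ?_) zero_lt_one
    rw [transportRate_circleLoop_im he hae]
    exact div_pos (mul_pos (by positivity) (hcos t ht)) (hden t (by linarith))
  -- The integrand stays below 2π exactly when 3r² (1 - cos) < 1 - |a|²; since 1 - cos ≤ 2, this is
  -- where the constant 6 comes from.
  have h2 : 0 < ∫ s in (0 : ℝ)..1, (2 * Real.pi - (transportRate (circleLoop a e r) s).im) := by
    refine intervalIntegral.intervalIntegral_pos_of_pos_on (intervalIntegrable_const.sub hint')
      (fun t ht => ?_) zero_lt_one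
    rw [transportRate_circleLoop_im he hae, sub_pos, div_lt_iff₀ (hden t (by linarith)),
      mul_assoc]
    refine mul_lt_mul_of_pos_left ?_ (by positivity)
    nlinarith [Real.neg_one_le_cos (2 * Real.pi * t)]
  rw [intervalIntegral.integral_sub intervalIntegrable_const hint'] at h2
  simp only [intervalIntegral.integral_const, sub_zero, one_smul] at h2
  rw [← him] at h1 h2
  intro h
  obtain ⟨n, hn⟩ := Complex.exp_eq_one_iff.1 h
  have h3 := congrArg Complex.im hn
  simp at h3
  have h4 : (-1 : ℝ) < n := by nlinarith
  have h5 : (n : ℝ) < 0 := by nlinarith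
  have h6 : (-1 : ℤ) < n := by exact_mod_cast h4
  have h7 : n < (0 : ℤ) := by exact_mod_cast h5
  omega

theorem not_isFlatNormalBundle (hk : 2 ≤ k) {a e : EuclideanSpace ℂ (Fin k)} (ha : a ∈ ball k)
    (he : ‖e‖ = 1) (hae : inner ℂ a e = 0) :
    ¬ IsFlatNormalBundle (metric k) (slice a (Submodule.span ℂ {e})) := by
  intro hflat
  obtain ⟨N, hN, hloop⟩ := hflat a ⟨ha, by simp⟩
  obtain ⟨δ, hδ, hNδ⟩ := Metric.mem_nhds_iff.1 hN
  obtain ⟨z, hz0, hz⟩ := exists_normal_ne_zero hk hae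
  have hh := one_sub_norm_sq_pos ha
  have hh1 : 1 - ‖a‖ ^ 2 ≤ 1 := by nlinarith [sq_nonneg ‖a‖]
  -- The circle stays within 2r of `a`, hence `δ / 2`; the bound by (1 - |a|²) / 6 suffices for the
  -- other condition because 1 - |a|² ≤ 1.
  obtain ⟨r, hr0, hr1, hr2⟩ : ∃ r : ℝ, 0 < r ∧ r < δ / 2 ∧ 6 * r ^ 2 < 1 - ‖a‖ ^ 2 := by
    refine ⟨min (δ / 3) ((1 - ‖a‖ ^ 2) / 6), by positivity, ?_, ?_⟩
    · exact (min_le_left _ _).trans_lt (by linarith)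
    · have h1 : min (δ / 3) ((1 - ‖a‖ ^ 2) / 6) ≤ (1 - ‖a‖ ^ 2) / 6 := min_le_right _ _
      have h2 : 0 < min (δ / 3) ((1 - ‖a‖ ^ 2) / 6) := by positivity
      nlinarith
  have hball : ∀ t, circleLoop a e r t ∈ ball k := by
    intro t
    have h1 : 0 < 1 - ‖circleLoop a e r t‖ ^ 2 := by
      rw [one_sub_norm_circleLoop_sq he hae]
      nlinarith [Real.neg_one_le_cos (2 * Real.pi * t), sq_nonneg r]
    rw [ball, mem_ball_zero_iff]
    nlinarith [norm_nonneg (circleLoop a e r t)]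
  have hslice : ∀ t, circleLoop a e r t ∈ slice a (Submodule.span ℂ {e}) := by
    refine fun t => ⟨hball t, ?_⟩
    rw [circleLoop, add_sub_cancel_left]
    exact Submodule.smul_mem _ _ (Submodule.mem_span_singleton_self e)
  have hmemN : ∀ t, circleLoop a e r t ∈ N := by
    refine fun t => hNδ ?_
    rw [Metric.mem_ball, dist_eq_norm, circleLoop, add_sub_cancel_left, norm_smul, he, mul_one,
      norm_mul, Complex.norm_real, Real.norm_eq_abs, abs_of_pos hr0]
    have h1 : ‖Complex.exp ((2 * Real.pi * t : ℝ) * Complex.I) - 1‖ ≤ 2 := by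
      refine (norm_sub_le _ _).trans ?_
      rw [Complex.norm_exp_ofReal_mul_I, norm_one]
      norm_num
    nlinarith
  have hc : ∀ E : Set (EuclideanSpace ℂ (Fin k)), (∀ t, circleLoop a e r t ∈ E) →
      IsPiecewiseSmoothLoop E a (circleLoop a e r) := by
    refine fun E hE => ⟨(contDiff_circleLoop a e r).continuous.continuousOn, fun t _ => hE t,
      by simp [circleLoop], ?_, 1, fun i => i, Nat.mono_cast, by simp, by simp,
      fun i _ => (contDiff_circleLoop a e r).contDiffOn⟩
    simp [circleLoop, Complex.exp_two_pi_mul_I]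
  have hPT := hloop _ (hc _ fun t => ⟨hslice t, hmemN t⟩) z ((mem_normalSpace_slice ha).2 hz)
  rw [parallelTranslate_iff ha (hc _ hslice) hz] at hPT
  refine exp_integral_transportRate_circleLoop_ne_one he hae hr0 hr2
    (intervalIntegrable_transportRate (hc _ hslice)) ?_
  refine smul_left_injective ℂ hz0 ?_
  simpa using hPT.symm

/-! ### The curvature identity and the main theorem -/

theorem curvature_J_normal {a x z : EuclideanSpace ℂ (Fin k)} (ha : a ∈ ball k)
    (hx : metric k a x x = 1) (hxz : herm a x z = 0) :
    curvature (metric k) a x (J x) z = (2 : ℝ) • J z := by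
  have h1 : herm a (J x) x = -Complex.I := by
    rw [J, herm_smul_left, herm_self, hx]
    simp
  have h2 : herm a (J x) z = 0 := by rw [J, herm_smul_left, hxz, mul_zero]
  rw [curvature_metric ha, h1, h2, hxz, ← herm_conj_symm a (J x) x, h1, J, J, ← Complex.coe_smul]
  simp only [Complex.star_def, map_neg, Complex.conj_I, zero_smul, Complex.ofReal_ofNat]
  module

end ComplexHyperbolic

theorem mainTheorem12 (k : ℕ) (hk : 1 ≤ k) (E : Set (EuclideanSpace ℂ (Fin k)))
    (hE : ComplexHyperbolic.IsComplexPlane k E) :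
    (∀ a ∈ E, ∀ c : ℝ → EuclideanSpace ℂ (Fin k),
      ChartGeometry.IsPiecewiseSmoothLoop E a c →
        (∀ z ∈ ChartGeometry.normalSpace (ComplexHyperbolic.metric k) E a,
          ∃ w ∈ ChartGeometry.normalSpace (ComplexHyperbolic.metric k) E a,
            ∀ w', ChartGeometry.ParallelTranslate (ComplexHyperbolic.metric k) c z w' ↔ w' = w) ∧
        ∀ C : Set (EuclideanSpace ℂ (Fin k)), ComplexHyperbolic.IsFiber k E a C →
          {w | ∃ z ∈ C, ChartGeometry.ParallelTranslate (ComplexHyperbolic.metric k) c z w} = C) ∧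
    (2 ≤ k → ¬ ChartGeometry.IsFlatNormalBundle (ComplexHyperbolic.metric k) E) ∧
    (∀ a ∈ E, ∀ x ∈ ChartGeometry.tangentDirs E a, ComplexHyperbolic.metric k a x x = 1 →
      ∀ z ∈ ChartGeometry.unitNormalSphere (ComplexHyperbolic.metric k) E a,
        ChartGeometry.curvature (ComplexHyperbolic.metric k) a x (ComplexHyperbolic.J x) z =
          (2 : ℝ) • ComplexHyperbolic.J z) := by
  obtain ⟨b, hb, u, hu, rfl⟩ := ComplexHyperbolic.IsComplexPlane.exists_eq_slice hE
  refine ⟨fun a ha c hc => ?_, fun hk2 => ?_, fun a ha x hx hx1 z hz => ?_⟩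
  · have hab := ha.1
    rw [ComplexHyperbolic.slice_eq_of_mem ha] at hc ⊢
    refine ⟨fun z hz => ?_, ?_⟩
    · have hz' := (ComplexHyperbolic.mem_normalSpace_slice hab).1 hz
      refine ⟨_, ?_, fun w' => ComplexHyperbolic.parallelTranslate_iff hab hc hz'⟩
      rw [ComplexHyperbolic.mem_normalSpace_slice hab]
      intro x hx
      rw [ComplexHyperbolic.herm_smul_right, hz' x hx, mul_zero]
    · rintro C ⟨L, hL, haL, -, rfl⟩
      obtain ⟨p, -, v, -, rfl⟩ := ComplexHyperbolic.IsComplexPlane.exists_eq_slice hL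
      -- Rebasing `L` at `a` exhibits its tangent space there as a complex line, which the scalar
      -- holonomy preserves.
      rw [ComplexHyperbolic.slice_eq_of_mem haL, ComplexHyperbolic.tangentDirs_slice hab]
      exact ComplexHyperbolic.holonomy_image_fiber hab hc
  · obtain ⟨a, e, ha, he, hae, h⟩ := ComplexHyperbolic.exists_unit_orthogonal_base hb hu
    rw [h]
    exact ComplexHyperbolic.not_isFlatNormalBundle hk2 ha he hae
  · rw [ComplexHyperbolic.slice_eq_of_mem ha] at hx hz
    have hz' := (ComplexHyperbolic.mem_normalSpace_slice ha.1).1 hz.1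
    rw [ComplexHyperbolic.tangentDirs_slice ha.1] at hx
    exact ComplexHyperbolic.curvature_J_normal ha.1 hx1 (hz' x hx)
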